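/- Let $k$ be a field. A commutative $\mathbb{N}$-graded $k$-algebra $R=\bigoplus_{i\ge 0}R_i$ is called standard if it is generated as a $k$-algebra by finitely many elements of $R_1$. A polynomial $P(x)\in\mathbb{Q}[x]$ is called a Hilbert polynomial (over $k$) if there are a standard graded $k$-algebra $R$ and a positive integer $N$ such that $\dim_k R_i=P(i)$ for all integers $i\ge N$. For $f(x)=\sum_{i=0}^{d}a_ix^i\in\mathbb{Z}[x]$ of degree $d$ put $S(f)=(\operatorname{sgn}(a_0),\ldots,\operatorname{sgn}(a_{d-1}))\in\{-1,0,1\}^d$, where $\operatorname{sgn}(a)$ is $-1$, $0$ or $1$ according to whether $a<0$, $a=0$ or $a>0$. Corollary. For every field $k$, every integer $d\ge 1$ and every $s=(s_0,\ldots,s_{d-1})\in\{-1,0,1\}^d$, there exists a polynomial $f(x)\in\mathbb{Z}[x]$ of degree $d$ that is a Hilbert polynomial over $k$ and satisfies $S(f)=s$. -/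

import Mathlib

open Polynomial

universe u v

/-- An `ℕ`-graded commutative `k`-algebra `R = ⨁ i, 𝒜 i` is *standard* if it is generated as a
`k`-algebra by finitely many elements of degree `1`. -/
def IsStandardGraded (k : Type u) [Field k] {R : Type v} [CommRing R] [Algebra k R]
    (𝒜 : ℕ → Submodule k R) [GradedAlgebra 𝒜] : Prop :=
  ∃ T : Finset R, (∀ t ∈ T, t ∈ 𝒜 1) ∧ Algebra.adjoin k (T : Set R) = ⊤

/-- The Hilbert function `H(R; i) = dim_k R_i` of a graded `k`-algebra. (All graded components
of a standard graded algebra are finite-dimensional.) -/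
noncomputable def hilbertFunction (k : Type u) [Field k] {R : Type v} [CommRing R] [Algebra k R]
    (𝒜 : ℕ → Submodule k R) [GradedAlgebra 𝒜] (i : ℕ) : ℕ :=
  Module.finrank k (𝒜 i)

/-- `P` is the Hilbert polynomial of the graded algebra `R = ⨁ i, 𝒜 i`: it agrees with the Hilbert
function at all sufficiently large integers. -/
def IsHilbertPolynomialOf (k : Type u) [Field k] {R : Type v} [CommRing R] [Algebra k R]
    (𝒜 : ℕ → Submodule k R) [GradedAlgebra 𝒜] (P : ℚ[X]) : Prop :=
  ∃ N : ℕ, 0 < N ∧ ∀ i : ℕ, N ≤ i → (hilbertFunction k 𝒜 i : ℚ) = P.eval (i : ℚ)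

/-- `P` is a Hilbert polynomial over `k`: it is the Hilbert polynomial of some standard graded
commutative `k`-algebra. -/
def IsHilbertPolynomial (k : Type u) [Field k] (P : ℚ[X]) : Prop :=
  ∃ (R : Type u) (_ : CommRing R) (_ : Algebra k R) (𝒜 : ℕ → Submodule k R)
    (_ : GradedAlgebra 𝒜), IsStandardGraded k 𝒜 ∧ IsHilbertPolynomialOf k 𝒜 P

/-- The signs `(sgn a_0, …, sgn a_{d-1})` of the non-leading coefficients of a polynomial
`f = a_0 + a_1 x + ⋯ + a_d x ^ d`, where `d` is the degree of `f`. -/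
noncomputable def signPattern (d : ℕ) (f : ℤ[X]) : Fin d → SignType :=
  fun i => SignType.sign (f.coeff (i : ℕ))

open scoped DirectSum TensorProduct

/-! For a finite-dimensional subspace `V` of a commutative algebra, `⨁ V ^ i` is standard graded, so
the eventual polynomial `dim V ^ i` is a Hilbert polynomial. Such polynomials are closed under sums
(product algebras) and products (tensor products). They include `1` and, via a two-cusped rational
quintic, `5x - 1`. Put `y = 5x`. Then `y = (y - 1) + 1` and `y ^ d - y ^ j = ∑ y ^ m (y - 1)` over
`j ≤ m < d` are available. Adding to `y ^ d` one term `y ^ j`, `0` or `y ^ d - y ^ j` for each `j <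
d` sets the sign at `x ^ j` and otherwise changes only the leading coefficient, which stays
positive. -/

/-- `P` eventually gives the dimensions of the powers of a finite-dimensional subspace of a
commutative `k`-algebra. -/
def IsPowerGrowth (k : Type u) [Field k] (P : ℚ[X]) : Prop :=
  ∃ (A : Type u) (_ : CommRing A) (_ : Algebra k A) (V : Submodule k A),
    V.FG ∧ ∃ N : ℕ, 0 < N ∧ ∀ i : ℕ, N ≤ i →
      (Module.finrank k (V ^ i : Submodule k A) : ℚ) = P.eval (i : ℚ)

/-! ### The graded algebra of powers of a subspace -/

section PowerAlgebra

variable {k : Type u} [Field k] {A : Type v} [CommRing A] [Algebra k A]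

/-- The graded algebra `⨁ i, V ^ i` of a subspace `V` of a commutative algebra. -/
abbrev PowerAlgebra (V : Submodule k A) : Type v :=
  ⨁ i, (V ^ i : Submodule k A)

noncomputable instance PowerAlgebra.commRing (V : Submodule k A) : CommRing (PowerAlgebra V) :=
  DirectSum.commRing _

noncomputable instance PowerAlgebra.algebra (V : Submodule k A) : Algebra k (PowerAlgebra V) :=
  inferInstance

/-- The homogeneous component of degree `i` of the algebra `⨁ i, V ^ i`. -/
noncomputable def powerComponent (V : Submodule k A) (i : ℕ) : @Submodule k (PowerAlgebra V) _
    (PowerAlgebra.commRing V).toCommSemiring.toAddCommMonoid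
    (PowerAlgebra.algebra V).toModule :=
  LinearMap.range (DirectSum.lof k ℕ (fun i => (V ^ i : Submodule k A)) i)

theorem of_mem_powerComponent (V : Submodule k A) (i : ℕ) (x : (V ^ i : Submodule k A)) :
    DirectSum.of (fun i => (V ^ i : Submodule k A)) i x ∈ powerComponent V i :=
  ⟨x, rfl⟩

instance powerComponent_gradedMonoid (V : Submodule k A) :
    SetLike.GradedMonoid (powerComponent V) where
  one_mem := of_mem_powerComponent V 0 _
  mul_mem := by
    rintro i j _ _ ⟨x, rfl⟩ ⟨y, rfl⟩
    simp only [DirectSum.lof_eq_of, DirectSum.of_mul_of]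
    exact of_mem_powerComponent V _ _

noncomputable instance powerComponent_decomposition (V : Submodule k A) :
    DirectSum.Decomposition (powerComponent V) :=
  DirectSum.Decomposition.ofLinearMap _
    (DirectSum.toModule k ℕ _ fun i =>
      (DirectSum.lof k ℕ (fun i => powerComponent V i) i).comp (LinearMap.rangeRestrict _))
    (by
      ext i x : 2
      simp only [LinearMap.comp_apply, DirectSum.toModule_lof, LinearMap.id_apply]
      exact DirectSum.coeLinearMap_lof _ _ _)
    (by
      ext i x : 2
      obtain ⟨_, x, rfl⟩ := x
      simp only [LinearMap.comp_apply, DirectSum.toModule_lof, DirectSum.coeLinearMap_lof,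
        LinearMap.id_apply]
      rfl)

noncomputable instance powerComponent_gradedAlgebra (V : Submodule k A) :
    GradedAlgebra (powerComponent V) where

theorem hilbertFunction_powerComponent (V : Submodule k A) (i : ℕ) :
    hilbertFunction k (R := PowerAlgebra V) (powerComponent V) i =
      Module.finrank k (V ^ i : Submodule k A) :=
  LinearMap.finrank_range_of_inj (DirectSum.of_injective (β := fun i => (V ^ i : Submodule k A)) i)

theorem isStandardGraded_powerComponent (V : Submodule k A) (hV : V.FG) :
    IsStandardGraded k (R := PowerAlgebra V) (powerComponent V) := by
  classical
  obtain ⟨S, hS⟩ : (powerComponent V 1).FG := by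
    have h : Module.Finite k (V ^ 1 : Submodule k A) :=
      Module.Finite.iff_fg.2 (by rwa [pow_one])
    exact Module.Finite.iff_fg.1 (Module.Finite.range _)
  refine ⟨S, fun t ht => hS ▸ Submodule.subset_span ht, ?_⟩
  have h1 : ∀ x ∈ powerComponent V 1, x ∈ Algebra.adjoin k (S : Set (PowerAlgebra V)) :=
    fun x hx => Algebra.span_le_adjoin k _ (hS ▸ hx)
  have key : ∀ (i : ℕ) (x : A) (hx : x ∈ V ^ i),
      DirectSum.of (fun i => (V ^ i : Submodule k A)) i ⟨x, hx⟩ ∈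
        Algebra.adjoin k (S : Set (PowerAlgebra V)) := by
    intro i x hx
    induction hx using Submodule.pow_induction_on_left' with
    | algebraMap r => exact Subalgebra.algebraMap_mem _ r
    | add x y i hx hy ihx ihy =>
      convert Subalgebra.add_mem _ ihx ihy
      rw [← map_add]; rfl
    | mem_mul m hm i x hx ih =>
      have hm' : m ∈ V ^ 1 := by rwa [pow_one]
      convert Subalgebra.mul_mem _ (h1 _ (of_mem_powerComponent V 1 ⟨m, hm'⟩)) ih
      rw [DirectSum.of_mul_of]
      -- The product lies in degree `1 + i`, the target in degree `i + 1`.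
      exact DirectSum.of_eq_of_gradedMonoid_eq (Sigma.subtype_ext (add_comm i 1) rfl)
  rw [eq_top_iff]
  rintro x -
  induction x using DirectSum.induction_on with
  | zero => exact Subalgebra.zero_mem _
  | of i x => exact key i x x.2
  | add x y hx hy => exact Subalgebra.add_mem _ hx hy

end PowerAlgebra

theorem IsPowerGrowth.isHilbertPolynomial {k : Type u} [Field k] {P : ℚ[X]}
    (h : IsPowerGrowth k P) : IsHilbertPolynomial k P := by
  obtain ⟨A, _, _, V, hV, N, hN, hP⟩ := h
  refine ⟨PowerAlgebra V, inferInstance, inferInstance, powerComponent V, inferInstance,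
    isStandardGraded_powerComponent V hV, N, hN, fun i hi => ?_⟩
  rw [hilbertFunction_powerComponent, hP i hi]

/-! ### Powers in product and tensor product algebras -/

section Operations

variable {k : Type u} [Field k] {A : Type v} [CommRing A] [Algebra k A]
  {B : Type v} [CommRing B] [Algebra k B]

theorem Submodule.prod_mul_prod (V V' : Submodule k A) (W W' : Submodule k B) :
    V.prod W * V'.prod W' = (V * V').prod (W * W') := by
  apply le_antisymm
  · rw [Submodule.mul_le]
    rintro ⟨a, b⟩ ⟨ha, hb⟩ ⟨a', b'⟩ ⟨ha', hb'⟩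
    exact ⟨Submodule.mul_mem_mul ha ha', Submodule.mul_mem_mul hb hb'⟩
  · have hl : ∀ a ∈ V * V', ((a, 0) : A × B) ∈ V.prod W * V'.prod W' := by
      intro a ha
      induction ha using Submodule.mul_induction_on' with
      | mem_mul_mem x hx y hy =>
        simpa using Submodule.mul_mem_mul (M := V.prod W) (N := V'.prod W')
          (m := (x, 0)) (n := (y, 0)) ⟨hx, W.zero_mem⟩ ⟨hy, W'.zero_mem⟩
      | add x _ y _ hx hy => simpa using add_mem hx hy
    have hr : ∀ b ∈ W * W', ((0, b) : A × B) ∈ V.prod W * V'.prod W' := by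
      intro b hb
      induction hb using Submodule.mul_induction_on' with
      | mem_mul_mem x hx y hy =>
        simpa using Submodule.mul_mem_mul (M := V.prod W) (N := V'.prod W')
          (m := (0, x)) (n := (0, y)) ⟨V.zero_mem, hx⟩ ⟨V'.zero_mem, hy⟩
      | add x _ y _ hx hy => simpa using add_mem hx hy
    rintro ⟨a, b⟩ ⟨ha, hb⟩
    simpa using add_mem (hl a ha) (hr b hb)

/-- Exponent `0` fails in general: the zeroth power is spanned by `(1, 1)` alone. -/
theorem Submodule.prod_pow (V : Submodule k A) (W : Submodule k B) {n : ℕ} (hn : n ≠ 0) :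
    V.prod W ^ n = (V ^ n).prod (W ^ n) := by
  induction n, Nat.one_le_iff_ne_zero.2 hn using Nat.le_induction with
  | base => simp only [pow_one]
  | succ n h ih => rw [pow_succ, ih (by omega), Submodule.prod_mul_prod, ← pow_succ, ← pow_succ]

theorem Submodule.finrank_prod_eq_add {V : Submodule k A} {W : Submodule k B} (hV : V.FG)
    (hW : W.FG) :
    Module.finrank k (V.prod W) = Module.finrank k V + Module.finrank k W := by
  have := Module.Finite.iff_fg.2 hV
  have := Module.Finite.iff_fg.2 hW
  have h : V.prod W = LinearMap.range (V.subtype.prodMap W.subtype) := by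
    rw [LinearMap.range_prodMap, Submodule.range_subtype, Submodule.range_subtype]
  rw [h, LinearMap.finrank_range_of_inj, Module.finrank_prod]
  exact Function.Injective.prodMap V.injective_subtype W.injective_subtype

/-- Over a field the images of `A` and `B` in `A ⊗ B` are linearly disjoint, so the product is a
copy of `V ⊗ W`. -/
theorem Submodule.finrank_map_includeLeft_mul_map_includeRight (V : Submodule k A)
    (W : Submodule k B) :
    Module.finrank k
      ↥(V.map (Algebra.TensorProduct.includeLeft : A →ₐ[k] A ⊗[k] B).toLinearMap *
        W.map (Algebra.TensorProduct.includeRight : B →ₐ[k] A ⊗[k] B).toLinearMap) =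
      Module.finrank k V * Module.finrank k W := by
  cases subsingleton_or_nontrivial A
  · rw [Module.finrank_zero_of_subsingleton, Module.finrank_zero_of_subsingleton (M := V), zero_mul]
  cases subsingleton_or_nontrivial B
  · rw [Module.finrank_zero_of_subsingleton, Module.finrank_zero_of_subsingleton (M := W), mul_zero]
  have H :
      (V.map (Algebra.TensorProduct.includeLeft : A →ₐ[k] A ⊗[k] B).toLinearMap).LinearDisjoint
      (W.map (Algebra.TensorProduct.includeRight : B →ₐ[k] A ⊗[k] B).toLinearMap) :=
    Submodule.LinearDisjoint.of_le_of_flat_right (Subalgebra.LinearDisjoint.include_range k A B)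
      (LinearMap.map_le_range) (LinearMap.map_le_range)
  rw [← H.mulMap.finrank_eq, Module.finrank_tensorProduct]
  congr 1
  · exact (V.equivMapOfInjective _ (Algebra.TensorProduct.includeLeft_injective (S := k)
      (algebraMap k B).injective)).finrank_eq.symm
  · exact (W.equivMapOfInjective _ (Algebra.TensorProduct.includeRight_injective
      (algebraMap k A).injective)).finrank_eq.symm

end Operations

namespace IsPowerGrowth

variable {k : Type u} [Field k] {P Q : ℚ[X]}

protected theorem zero : IsPowerGrowth k 0 := by
  refine ⟨k, _, _, ⊥, Submodule.fg_bot, 1, one_pos, fun i hi => ?_⟩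
  rw [Submodule.bot_pow (by omega)]
  simp

protected theorem one : IsPowerGrowth k 1 := by
  refine ⟨k, _, _, 1, ?_, 1, one_pos, fun i hi => ?_⟩
  · rw [Submodule.one_eq_span]
    exact Submodule.fg_span_singleton _
  · rw [one_pow, Submodule.one_eq_span, finrank_span_singleton one_ne_zero]
    simp

protected theorem add (hP : IsPowerGrowth k P) (hQ : IsPowerGrowth k Q) :
    IsPowerGrowth k (P + Q) := by
  obtain ⟨A, _, _, V, hV, N, hN, hP⟩ := hP
  obtain ⟨B, _, _, W, hW, M, hM, hQ⟩ := hQ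
  refine ⟨A × B, inferInstance, inferInstance, V.prod W, hV.prod hW, N + M, by omega,
    fun i hi => ?_⟩
  rw [Submodule.prod_pow _ _ (by omega), Submodule.finrank_prod_eq_add (hV.pow i) (hW.pow i),
    eval_add, ← hP i (by omega), ← hQ i (by omega), Nat.cast_add]

protected theorem mul (hP : IsPowerGrowth k P) (hQ : IsPowerGrowth k Q) :
    IsPowerGrowth k (P * Q) := by
  obtain ⟨A, _, _, V, hV, N, hN, hP⟩ := hP
  obtain ⟨B, _, _, W, hW, M, hM, hQ⟩ := hQ
  refine ⟨A ⊗[k] B, inferInstance, inferInstance,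
    V.map (Algebra.TensorProduct.includeLeft : A →ₐ[k] A ⊗[k] B).toLinearMap *
      W.map (Algebra.TensorProduct.includeRight : B →ₐ[k] A ⊗[k] B).toLinearMap,
    (hV.map _).mul (hW.map _), N + M, by omega, fun i hi => ?_⟩
  rw [mul_pow, ← Submodule.map_pow, ← Submodule.map_pow,
    Submodule.finrank_map_includeLeft_mul_map_includeRight,
    eval_mul, ← hP i (by omega), ← hQ i (by omega), Nat.cast_mul]

protected theorem pow (hP : IsPowerGrowth k P) (n : ℕ) : IsPowerGrowth k (P ^ n) := by
  induction n with
  | zero => simpa using IsPowerGrowth.one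
  | succ n ih => rw [pow_succ]; exact ih.mul hP

protected theorem sum {ι : Type*} {s : Finset ι} {F : ι → ℚ[X]}
    (h : ∀ i ∈ s, IsPowerGrowth k (F i)) : IsPowerGrowth k (∑ i ∈ s, F i) :=
  Finset.sum_induction F (IsPowerGrowth k) (fun _ _ => IsPowerGrowth.add) IsPowerGrowth.zero h

end IsPowerGrowth

/-! ### A rational quintic with Hilbert polynomial `5x - 1` -/

section Curve

open scoped Pointwise

/-- The exponents of the monomials in the `n`-th power of the span of `1, X ^ 2, X ^ 3, X ^ 5`. -/
def curveExponents (n : ℕ) : Finset ℕ :=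
  (Finset.range (5 * n + 1)).filter fun j => j ≠ 1 ∧ j + 1 ≠ 5 * n

theorem curveExponents_add_one {n : ℕ} (hn : 1 ≤ n) :
    curveExponents n + curveExponents 1 = curveExponents (n + 1) := by
  ext j
  simp only [curveExponents, Finset.mem_add, Finset.mem_filter, Finset.mem_range]
  constructor
  · rintro ⟨a, ha, b, hb, rfl⟩
    omega
  · intro hj
    by_cases h0 : j ≤ 5 * n ∧ j + 1 ≠ 5 * n
    · exact ⟨j, by omega, 0, by omega, by omega⟩
    by_cases h1 : j = 5 * n + 5
    · exact ⟨5 * n, by omega, 5, by omega, by omega⟩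
    -- The generators `3` and `2` bypass the gap of the `n`-th power at `5 * n - 1`.
    by_cases h2 : j = 5 * n + 1
    · exact ⟨5 * n - 2, by omega, 3, by omega, by omega⟩
    by_cases h3 : j = 5 * n - 1
    · exact ⟨5 * n - 3, by omega, 2, by omega, by omega⟩
    by_cases h4 : j = 5 * n + 2
    · exact ⟨5 * n, by omega, 2, by omega, by omega⟩
    · exact ⟨5 * n, by omega, 3, by omega, by omega⟩

theorem card_curveExponents {n : ℕ} (hn : 1 ≤ n) : (curveExponents n).card = 5 * n - 1 := by
  have h : curveExponents n = (Finset.range (5 * n + 1)) \ {1, 5 * n - 1} := by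
    ext j
    simp only [curveExponents, Finset.mem_filter, Finset.mem_range, Finset.mem_sdiff,
      Finset.mem_insert, Finset.mem_singleton]
    omega
  rw [h, Finset.card_sdiff_of_subset, Finset.card_range, Finset.card_pair (by omega)]
  · omega
  · intro j
    simp only [Finset.mem_range, Finset.mem_insert, Finset.mem_singleton]
    omega

variable (k : Type u) [Field k]

/-- The span of the monomials with exponents in `T`. -/
noncomputable def monomialSpan (T : Finset ℕ) : Submodule k k[X] :=
  Submodule.span k ((fun j => (X : k[X]) ^ j) '' (T : Set ℕ))

theorem monomialSpan_mul (S T : Finset ℕ) :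
    monomialSpan k S * monomialSpan k T = monomialSpan k (S + T) := by
  rw [monomialSpan, monomialSpan, monomialSpan, Submodule.span_mul_span]
  congr 1
  ext p
  simp only [Set.mem_mul, Set.mem_image, Finset.mem_coe, Finset.mem_add]
  constructor
  · rintro ⟨_, ⟨a, ha, rfl⟩, _, ⟨b, hb, rfl⟩, rfl⟩
    exact ⟨a + b, ⟨a, ha, b, hb, rfl⟩, pow_add _ _ _⟩
  · rintro ⟨_, ⟨a, ha, b, hb, rfl⟩, rfl⟩
    exact ⟨_, ⟨a, ha, rfl⟩, _, ⟨b, hb, rfl⟩, (pow_add _ _ _).symm⟩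

theorem finrank_monomialSpan (T : Finset ℕ) : Module.finrank k (monomialSpan k T) = T.card := by
  have hli : LinearIndependent k fun j : T => (X : k[X]) ^ (j : ℕ) := by
    have := (Polynomial.basisMonomials k).linearIndependent
    simp only [Polynomial.coe_basisMonomials, Polynomial.monomial_one_right_eq_X_pow] at this
    exact this.comp _ Subtype.val_injective
  have h := finrank_span_eq_card hli
  rw [Fintype.card_coe] at h
  rw [← h, monomialSpan, Set.image_eq_range]
  rfl

theorem monomialSpan_curveExponents_pow {n : ℕ} (hn : 1 ≤ n) :
    monomialSpan k (curveExponents 1) ^ n = monomialSpan k (curveExponents n) := by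
  induction n, hn using Nat.le_induction with
  | base => rw [pow_one]
  | succ n h ih => rw [pow_succ, ih, monomialSpan_mul, curveExponents_add_one h]

theorem IsPowerGrowth.five_mul_X_sub_one : IsPowerGrowth k (5 * X - 1) := by
  refine ⟨k[X], inferInstance, inferInstance, monomialSpan k (curveExponents 1),
    Submodule.fg_span ((Finset.finite_toSet _).image _), 1, one_pos, fun i hi => ?_⟩
  rw [monomialSpan_curveExponents_pow k hi, finrank_monomialSpan, card_curveExponents hi,
    Nat.cast_sub (by omega)]
  simp

theorem IsPowerGrowth.five_mul_X : IsPowerGrowth k (5 * X) := by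
  simpa using (five_mul_X_sub_one k).add IsPowerGrowth.one

/-- Telescoping: with `y = 5x`, raising `d` by one adds `y ^ d (y - 1)`. -/
theorem IsPowerGrowth.five_mul_X_pow_sub {d j : ℕ} (h : j ≤ d) :
    IsPowerGrowth k ((5 * X) ^ d - (5 * X) ^ j) := by
  induction d, h using Nat.le_induction with
  | base => simpa using IsPowerGrowth.zero
  | succ d h ih =>
    convert ih.add (((five_mul_X k).pow d).mul (five_mul_X_sub_one k)) using 1
    ring

end Curve

/-! ### Prescribing the signs -/

/-- The polynomial `y ^ d`, or `0`, or `y ^ d - y ^ j` according to the sign `1`, `0`, `-1`,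
where `y = 5 x`. -/
noncomputable def signSummand (d : ℕ) (e : SignType) (j : ℕ) : ℤ[X] :=
  if e = 1 then (5 * X) ^ j else if e = -1 then (5 * X) ^ d - (5 * X) ^ j else 0

theorem five_mul_X_pow_coeff (i j : ℕ) :
    ((5 * X : ℤ[X]) ^ j).coeff i = if i = j then 5 ^ j else 0 := by
  rw [mul_pow, show (5 : ℤ[X]) = C 5 from rfl, ← C_pow, coeff_C_mul_X_pow]

theorem signSummand_coeff_of_lt {d i : ℕ} (hi : i < d) (e : SignType) (j : ℕ) :
    (signSummand d e j).coeff i = if i = j then (e : ℤ) * 5 ^ j else 0 := by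
  unfold signSummand
  cases e <;> simp [five_mul_X_pow_coeff, hi.ne, neg_ite]

/-- Ensures that the leading term `y ^ d` of the final sum is never cancelled. -/
theorem signSummand_coeff_self_nonneg {d j : ℕ} (hj : j < d) (e : SignType) :
    0 ≤ (signSummand d e j).coeff d := by
  unfold signSummand
  cases e <;> simp [five_mul_X_pow_coeff, hj.ne']

theorem signSummand_natDegree_le {d j : ℕ} (hj : j < d) (e : SignType) :
    (signSummand d e j).natDegree ≤ d := by
  rw [natDegree_le_iff_coeff_eq_zero]
  intro n hn
  unfold signSummand
  cases e <;> simp [five_mul_X_pow_coeff, hn.ne', (hj.trans hn).ne']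

theorem isPowerGrowth_signSummand (k : Type u) [Field k] {d j : ℕ} (hj : j ≤ d) (e : SignType) :
    IsPowerGrowth k ((signSummand d e j).map (Int.castRingHom ℚ)) := by
  unfold signSummand
  split_ifs
  · simpa using (IsPowerGrowth.five_mul_X k).pow j
  · simpa using IsPowerGrowth.five_mul_X_pow_sub k hj
  · simpa using IsPowerGrowth.zero

theorem mainTheorem2 (k : Type u) [Field k] (d : ℕ) (hd : 1 ≤ d) (s : Fin d → SignType) :
    ∃ f : ℤ[X], f.degree = (d : WithBot ℕ) ∧
      IsHilbertPolynomial k (f.map (Int.castRingHom ℚ)) ∧ signPattern d f = s := by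
  refine ⟨(5 * X) ^ d + ∑ j, signSummand d (s j) j, ?_, ?_, ?_⟩
  · have hpos : 0 < ((5 * X : ℤ[X]) ^ d + ∑ j, signSummand d (s j) j).coeff d := by
      rw [coeff_add, five_mul_X_pow_coeff, if_pos rfl, finsetSum_coeff]
      have := Finset.sum_nonneg fun j (_ : j ∈ Finset.univ) =>
        signSummand_coeff_self_nonneg (j : Fin d).2 (s j)
      positivity
    refine degree_eq_of_le_of_coeff_ne_zero (natDegree_le_iff_degree_le.1 ?_) hpos.ne'
    refine natDegree_add_le_of_degree_le ?_
      (natDegree_sum_le_of_forall_le _ _ fun j _ => signSummand_natDegree_le j.2 _)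
    rw [natDegree_le_iff_coeff_eq_zero]
    intro n hn
    rw [five_mul_X_pow_coeff, if_neg hn.ne']
  · apply IsPowerGrowth.isHilbertPolynomial
    rw [Polynomial.map_add, Polynomial.map_sum]
    refine IsPowerGrowth.add ?_
      (IsPowerGrowth.sum fun j _ => isPowerGrowth_signSummand k j.2.le (s j))
    simpa using (IsPowerGrowth.five_mul_X k).pow d
  · funext i
    have h : ((5 * X : ℤ[X]) ^ d + ∑ j, signSummand d (s j) j).coeff (i : ℕ) =
        (s i : ℤ) * 5 ^ (i : ℕ) := by
      rw [coeff_add, five_mul_X_pow_coeff, if_neg i.2.ne, zero_add, finsetSum_coeff]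
      simp only [signSummand_coeff_of_lt i.2, Fin.val_inj]
      simp
    rw [signPattern, h]
    cases s i <;> simp
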